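/- Let $X$ be a real or complex Banach space, with norm dual $X^*$. For a Banach space $E$, let $\mathcal S(E)$ be the family of all closed separable linear subspaces of $E$ (complex-linear if $E$ is complex). A family $\mathcal R\subset\mathcal S(E)$ is called rich in $E$ if every $V\in\mathcal S(E)$ is contained in some $V'\in\mathcal R$, and $\overline{\bigcup_{n} V_n}\in\mathcal R$ for every increasing sequence $V_1\subset V_2\subset\cdots$ in $\mathcal R$. A real Banach space is called Asplund if every continuous convex real-valued function defined on an open convex subset $\Omega$ of it is Fréchet differentiable at each point of a dense subset of $\Omega$; a complex Banach space is called Asplund if its underlying real Banach space is Asplund. Then the following assertions are equivalent. (i) $X$ is an Asplund space. (ii) Every separable linear subspace of $X$ has separable dual. (iii) There is a family $\mathcal A$ of rectangles $V\times Y$, with $V\in\mathcal S(X)$ and $Y\in\mathcal S(X^*)$, such that $\mathcal A$ is rich in $X\times X^*$; $Y_1\subset Y_2$ whenever $V_1\times Y_1$ and $V_2\times Y_2$ are in $\mathcal A$ and $V_1\subset V_2$; and for every $V\times Y\in\mathcal A$ the assignment $Y\ni x^*\mapsto x^*|_V\in V^*$ is a surjective isometry. -/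

import Mathlib

/-- A real normed space is Asplund if every continuous convex function on an open convex subset
`Ω` is Fréchet differentiable at each point of a dense subset of `Ω`. -/
def IsRealAsplund (E : Type*) [NormedAddCommGroup E] [NormedSpace ℝ E] : Prop :=
  ∀ (Ω : Set E) (f : E → ℝ), IsOpen Ω → Convex ℝ Ω → ConvexOn ℝ Ω f → ContinuousOn f Ω →
    Ω ⊆ closure {x ∈ Ω | DifferentiableAt ℝ f x}

/-- A real or complex normed space is Asplund if the underlying real normed space is Asplund. -/
def IsAsplund (𝕜 : Type*) [RCLike 𝕜] (X : Type*) [NormedAddCommGroup X] [NormedSpace 𝕜 X] :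
    Prop :=
  letI : NormedSpace ℝ X := NormedSpace.restrictScalars ℝ 𝕜 X
  IsRealAsplund X

/-- Over `ℝ`, passing to the underlying real space changes nothing. -/
theorem isAsplund_real_iff (X : Type*) [NormedAddCommGroup X] [h : NormedSpace ℝ X] :
    IsAsplund ℝ X ↔ IsRealAsplund X := by
  have e : NormedSpace.restrictScalars ℝ ℝ X = h :=
    NormedSpace.restrictScalars_eq ℝ ℝ
  unfold IsAsplund
  rw [e]

/-- The family `𝒮(E)` of all closed separable linear subspaces of `E`. -/
def closedSeparableSubspaces (𝕜 : Type*) [RCLike 𝕜] (E : Type*) [NormedAddCommGroup E]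
    [NormedSpace 𝕜 E] : Set (Submodule 𝕜 E) :=
  {V | IsClosed (V : Set E) ∧ TopologicalSpace.IsSeparable (V : Set E)}

/-- A family of closed separable subspaces of `E` is rich in `E` if it is cofinal and
`σ`-closed. For an increasing sequence the supremum of subspaces is their union. -/
structure IsRichFamily {𝕜 : Type*} [RCLike 𝕜] {E : Type*} [NormedAddCommGroup E]
    [NormedSpace 𝕜 E] (R : Set (Submodule 𝕜 E)) : Prop where
  subset : R ⊆ closedSeparableSubspaces 𝕜 E
  cofinal : ∀ V ∈ closedSeparableSubspaces 𝕜 E, ∃ V' ∈ R, V ≤ V'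
  sigma_closed : ∀ V : ℕ → Submodule 𝕜 E, Monotone V → (∀ n, V n ∈ R) →
    (⨆ n, V n).topologicalClosure ∈ R

/-- The family of all rectangles `V × Y` in `X × Z`, with `V ∈ 𝒮(X)` and `Y ∈ 𝒮(Z)`. -/
def rectangles (𝕜 : Type*) [RCLike 𝕜] (X Z : Type*) [NormedAddCommGroup X] [NormedSpace 𝕜 X]
    [NormedAddCommGroup Z] [NormedSpace 𝕜 Z] : Set (Submodule 𝕜 (X × Z)) :=
  {W | ∃ V ∈ closedSeparableSubspaces 𝕜 X, ∃ Y ∈ closedSeparableSubspaces 𝕜 Z, W = V.prod Y}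

/-- The restriction map `Y → V*`, `x* ↦ x*|_V`, for subspaces `V ⊆ X` and `Y ⊆ X*`. -/
noncomputable def restrictToSubspace {𝕜 : Type*} [RCLike 𝕜] {X : Type*} [NormedAddCommGroup X]
    [NormedSpace 𝕜 X] (V : Submodule 𝕜 X) (Y : Submodule 𝕜 (StrongDual 𝕜 X)) :
    Y → StrongDual 𝕜 V :=
  fun y => (y : StrongDual 𝕜 X).comp V.subtypeL

/-!
The three assertions are equivalent to a fourth one: the dual `X*` is weak-star fragmented
(`IsDualFragmented`), that is, every nonempty bounded weak-star compact subset of `X*` has nonempty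
relatively weak-star open subsets of arbitrarily small norm diameter.

Fragmentability follows from the Asplund property because the support function of a bounded set
`K ⊆ X*` is continuous and convex, and at a point where it is Fréchet differentiable it cuts small
slices off `K` (`IsRealAsplund.isDualFragmented`). It also follows from the separability of the
duals of separable subspaces, since a non-fragmented compact set carries a Cantor tree whose
branches are separated uniformly by countably many vectors of the unit ball
(`isDualFragmented_of_separable_duals`).

Conversely, removing small relatively open pieces of a dual ball one after another yields a rank
`ρ`, an ordinal-valued function on the ball which is weak-star upper semicontinuous and has level
sets of small diameter (`IsDualFragmented.exists_rank`). Such a function attains its maximum on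
nonempty compact sets, and this is used twice.

* For a convex `f`, the maximal rank of a subgradient of `f` at `x` is upper semicontinuous in `x`.
  As the ordinals are well-ordered it has a minimum, near which it is constant. There the
  subgradients of maximal rank differ little from each other, so that `f` is linear up to a small
  Lipschitz error; Baire's theorem then gives the Asplund property
  (`IsDualFragmented.isRealAsplund`).
* For a subspace `V` of `X`, call a rank visible on `V` if it is the maximal rank of the functionals
  in the unit ball with some prescribed restriction to `V`. Let `Y(V)` be the closed span of fixed
  representatives of the ranks visible on `V`. The visible ranks increase with `V`, do not change
  when `V` is replaced by its closure, commute with directed unions by compactness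
  (`visibleRanks_iSup_subset`), and are countable in number if `V` is separable
  (`countable_visibleRanks`). Taking norm-preserving extensions of maximal rank shows that
  the restrictions of the representatives come within `1 / 2` of every element of the unit ball of
  `V*`, so that `Y(V)` is mapped onto `V*` as soon as the restriction is isometric. The rectangles
  `V × Y(V)` for which it is isometric form the rich family
  (`IsDualFragmented.exists_rich_family`).

Finally, a rich family of rectangles gives separable duals, because `V*` is a continuous image of
the separable space `Y` whenever `V ⊆ V'` and `V' × Y` is in the family.
-/

open Metric Set Filter Topology

universe u v

/-! ### Weak-star fragmentability and the associated rank -/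

/-- The closed ball of radius `R` of `X*`, as a subset of the weak-star dual. -/
def dualBall (𝕜 : Type*) [RCLike 𝕜] (X : Type*) [NormedAddCommGroup X] [NormedSpace 𝕜 X] (R : ℝ) :
    Set (WeakDual 𝕜 X) :=
  WeakDual.toStrongDual ⁻¹' closedBall 0 R

/-- The dual of `X` is weak-star fragmented: every nonempty bounded weak-star compact set has
nonempty relatively weak-star open subsets of arbitrarily small norm diameter. -/
def IsDualFragmented (𝕜 : Type*) [RCLike 𝕜] (X : Type*) [NormedAddCommGroup X]
    [NormedSpace 𝕜 X] : Prop :=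
  ∀ R ε : ℝ, 0 < ε → ∀ K : Set (WeakDual 𝕜 X), IsCompact K → K.Nonempty → K ⊆ dualBall 𝕜 X R →
    ∃ O : Set (WeakDual 𝕜 X), IsOpen O ∧ (O ∩ K).Nonempty ∧
      ∀ c ∈ O ∩ K, ∀ d ∈ O ∩ K, ‖WeakDual.toStrongDual c - WeakDual.toStrongDual d‖ ≤ ε

section Basics

variable {𝕜 : Type u} [RCLike 𝕜] {X : Type v} [NormedAddCommGroup X] [NormedSpace 𝕜 X]

theorem isCompact_dualBall (R : ℝ) : IsCompact (dualBall 𝕜 X R) :=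
  WeakDual.isCompact_closedBall 0 R

theorem mem_dualBall {R : ℝ} {c : WeakDual 𝕜 X} :
    c ∈ dualBall 𝕜 X R ↔ ‖WeakDual.toStrongDual c‖ ≤ R := by
  simp [dualBall]

theorem norm_apply_le_of_mem_dualBall {R : ℝ} {c : WeakDual 𝕜 X} (hc : c ∈ dualBall 𝕜 X R)
    (x : X) : ‖c x‖ ≤ R * ‖x‖ :=
  (WeakDual.toStrongDual c).le_of_opNorm_le (mem_dualBall.1 hc) x

/-- The norm of a functional is controlled by its real part, as one sees by rotating vectors. -/
theorem norm_le_of_re_apply_le {c : StrongDual 𝕜 X} {C : ℝ} (hC : 0 ≤ C)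
    (h : ∀ x, RCLike.re (c x) ≤ C * ‖x‖) : ‖c‖ ≤ C := by
  refine c.opNorm_le_bound hC fun x => ?_
  by_cases hx : c x = 0
  · rw [hx, norm_zero]
    positivity
  have hn : ‖c x‖ ≠ 0 := norm_ne_zero_iff.2 hx
  have h1 := h (((starRingEnd 𝕜) (c x) / (‖c x‖ : 𝕜)) • x)
  have h2 : c (((starRingEnd 𝕜) (c x) / (‖c x‖ : 𝕜)) • x) = ((‖c x‖ : ℝ) : 𝕜) := by
    have hn' : ((‖c x‖ : ℝ) : 𝕜) ≠ 0 := by exact_mod_cast hn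
    rw [map_smul, smul_eq_mul, div_mul_eq_mul_div, RCLike.conj_mul, pow_two, mul_div_assoc,
      div_self hn', mul_one]
  rw [h2, RCLike.ofReal_re, norm_smul, norm_div, RCLike.norm_conj, RCLike.norm_ofReal, abs_norm,
    div_self hn, one_mul] at h1
  exact h1

/-- As `norm_le_of_re_apply_le`, with the bound assumed on a ball around the origin only. -/
theorem norm_le_of_re_apply_le_on_ball {c : StrongDual 𝕜 X} {C δ : ℝ} (hC : 0 ≤ C) (hδ : 0 < δ)
    (h : ∀ x, ‖x‖ ≤ δ → RCLike.re (c x) ≤ C * δ) : ‖c‖ ≤ C := by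
  refine norm_le_of_re_apply_le hC fun x => ?_
  by_cases hx : x = 0
  · simp [hx]
  have hn : 0 < ‖x‖ := norm_pos_iff.2 hx
  have h1 := h (((δ / ‖x‖ : ℝ) : 𝕜) • x) (by
    rw [norm_smul, RCLike.norm_ofReal, abs_of_pos (by positivity), div_mul_cancel₀ _ hn.ne'])
  rw [map_smul, smul_eq_mul, RCLike.re_ofReal_mul] at h1
  have h2 : RCLike.re (c x) = (δ / ‖x‖ * RCLike.re (c x)) * (‖x‖ / δ) := by
    field_simp
  rw [h2]
  calc _ ≤ C * δ * (‖x‖ / δ) := by gcongr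
    _ = _ := by field_simp

/-- A fragmented dual ball carries an upper semicontinuous rank with values in the ordinals whose
level sets have norm diameter at most `ε`. It is obtained by exhausting the ball: at each step a
relatively open subset of small diameter of what remains is removed. -/
theorem IsDualFragmented.exists_rank (hX : IsDualFragmented 𝕜 X) (R : ℝ) {ε : ℝ} (hε : 0 < ε) :
    ∃ ρ : WeakDual 𝕜 X → Ordinal.{max u v},
      (∀ ξ, IsCompact {c ∈ dualBall 𝕜 X R | ξ ≤ ρ c}) ∧
      ∀ c ∈ dualBall 𝕜 X R, ∀ d ∈ dualBall 𝕜 X R, ρ c = ρ d →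
        ‖WeakDual.toStrongDual c - WeakDual.toStrongDual d‖ ≤ ε := by
  classical
  set B := dualBall 𝕜 X R with hB
  have hO : ∀ U : Set (WeakDual 𝕜 X), ∃ O : Set (WeakDual 𝕜 X), IsOpen O ∧
      (∀ c ∈ O ∩ (B \ U), ∀ d ∈ O ∩ (B \ U), IsOpen U →
        ‖WeakDual.toStrongDual c - WeakDual.toStrongDual d‖ ≤ ε) ∧
      (IsOpen U → (B \ U).Nonempty → (O ∩ (B \ U)).Nonempty) := by
    intro U
    by_cases h : IsOpen U ∧ (B \ U).Nonempty
    · obtain ⟨O, h1, h2, h3⟩ := hX R ε hε (B \ U) ((isCompact_dualBall R).diff h.1) h.2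
        sdiff_subset
      exact ⟨O, h1, fun c hc d hd _ => h3 c hc d hd, fun _ _ => h2⟩
    · exact ⟨∅, isOpen_empty, by simp, fun h1 h2 => (h ⟨h1, h2⟩).elim⟩
  choose O hOo hOd hOn using hO
  -- `W ξ` is the piece removed at stage `ξ`, and `U ξ` what has been removed before.
  let W : Ordinal.{max u v} → Set (WeakDual 𝕜 X) :=
    WellFounded.fix Ordinal.lt_wf fun ξ W => O (⋃ η : Iio ξ, W η.1 η.2)
  let U : Ordinal.{max u v} → Set (WeakDual 𝕜 X) := fun ξ => ⋃ η : Iio ξ, W η.1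
  have hW : ∀ ξ, W ξ = O (U ξ) := fun ξ => WellFounded.fix_eq _ _ ξ
  have hWo : ∀ ξ, IsOpen (W ξ) := fun ξ => hW ξ ▸ hOo _
  have hUo : ∀ ξ, IsOpen (U ξ) := fun ξ => isOpen_iUnion fun η => hWo _
  have hex : ∀ c ∈ B, ∃ ξ, c ∈ W ξ := by
    by_contra! hcon
    obtain ⟨c, hcB, hc⟩ := hcon
    have hne : ∀ ξ, (W ξ ∩ (B \ U ξ)).Nonempty := by
      intro ξ
      rw [hW]
      exact hOn _ (hUo ξ) ⟨c, hcB, by simpa [U] using fun η _ => hc η⟩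
    choose g hg using hne
    have hlt : ∀ ξ η, ξ < η → g ξ ≠ g η := by
      intro ξ η h heq
      exact (hg η).2.2 (mem_iUnion.2 ⟨⟨ξ, h⟩, heq ▸ (hg ξ).1⟩)
    refine not_injective_of_ordinal g fun ξ η h => ?_
    rcases lt_trichotomy ξ η with h' | h' | h'
    · exact (hlt _ _ h' h).elim
    · exact h'
    · exact (hlt _ _ h' h.symm).elim
  let ρ : WeakDual 𝕜 X → Ordinal.{max u v} := fun c => sInf {ξ | c ∈ W ξ}
  have hρW : ∀ c ∈ B, c ∈ W (ρ c) := fun c hc => csInf_mem (hex c hc)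
  have hρU : ∀ c ∈ B, ∀ ξ, c ∈ U ξ ↔ ρ c < ξ := by
    intro c hc ξ
    constructor
    · intro h
      obtain ⟨⟨η, hη⟩, h'⟩ := mem_iUnion.1 h
      exact lt_of_le_of_lt (csInf_le' h') hη
    · intro h
      exact mem_iUnion.2 ⟨⟨ρ c, h⟩, hρW c hc⟩
  refine ⟨ρ, fun ξ => ?_, fun c hc d hd h => ?_⟩
  · have : {c ∈ B | ξ ≤ ρ c} = B \ U ξ := by
      ext c
      simp only [mem_ofPred_eq, Set.mem_sdiff]
      exact and_congr_right fun hc => by rw [hρU c hc, not_lt]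
    rw [this]
    exact (isCompact_dualBall R).diff (hUo ξ)
  · refine hOd (U (ρ c)) c ⟨hW _ ▸ hρW c hc, hc, ?_⟩ d ⟨?_, hd, ?_⟩ (hUo _)
    · rw [hρU c hc]; exact lt_irrefl _
    · rw [h, ← hW]; exact hρW d hd
    · rw [hρU d hd, h]; exact lt_irrefl _

/-- An upper semicontinuous rank attains its maximum on nonempty compact sets. -/
theorem exists_max_rank {B : Set (WeakDual 𝕜 X)} {ρ : WeakDual 𝕜 X → Ordinal}
    (hρ : ∀ ξ, IsCompact {c ∈ B | ξ ≤ ρ c}) {H : Set (WeakDual 𝕜 X)} (hH : IsCompact H)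
    (hne : H.Nonempty) (hHB : H ⊆ B) : ∃ c ∈ H, ∀ d ∈ H, ρ d ≤ ρ c := by
  have : Nonempty H := hne.to_subtype
  obtain ⟨c, hc⟩ := IsCompact.nonempty_iInter_of_directed_nonempty_isCompact_isClosed
    (fun d : H => H ∩ {c ∈ B | ρ d ≤ ρ c})
    (fun d e => by
      rcases le_total (ρ d) (ρ e) with h | h
      · exact ⟨e, fun c hc => ⟨hc.1, hc.2.1, h.trans hc.2.2⟩, subset_rfl⟩
      · exact ⟨d, subset_rfl, fun c hc => ⟨hc.1, hc.2.1, h.trans hc.2.2⟩⟩)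
    (fun d => ⟨d, d.2, hHB d.2, le_rfl⟩)
    (fun d => hH.inter (hρ _))
    (fun d => (hH.inter (hρ _)).isClosed)
  rw [mem_iInter] at hc
  exact ⟨c, (hc ⟨_, hne.some_mem⟩).1, fun d hd => (hc ⟨d, hd⟩).2.2⟩

end Basics

section AsplundToFragmented

variable {𝕜 : Type u} [RCLike 𝕜] {X : Type v} [NormedAddCommGroup X] [NormedSpace 𝕜 X]

/-! ### Support functions: Asplund spaces have fragmented duals -/

/-- If `K ⊆ X*` is bounded, its support function `p x = sup_{c ∈ K} Re c x` is convex and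
continuous. At a point of Fréchet differentiability of `p`, small slices of `K` have small
diameter (Šmulyan). -/
theorem IsRealAsplund.isDualFragmented [NormedSpace ℝ X] [IsScalarTower ℝ 𝕜 X]
    (hX : IsRealAsplund X) : IsDualFragmented 𝕜 X := by
  intro R ε hε K hK hKne hKR
  have : Nonempty K := hKne.to_subtype
  have hR : 0 ≤ R := (norm_nonneg _).trans (mem_dualBall.1 (hKR hKne.some_mem))
  have hle : ∀ c ∈ K, ∀ x : X, RCLike.re (c x) ≤ R * ‖x‖ := fun c hc x =>
    (RCLike.re_le_norm _).trans (norm_apply_le_of_mem_dualBall (hKR hc) x)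
  let p : X → ℝ := fun x => ⨆ c : K, RCLike.re ((c : WeakDual 𝕜 X) x)
  have hbdd : ∀ x : X, BddAbove (range fun c : K => RCLike.re ((c : WeakDual 𝕜 X) x)) := fun x =>
    ⟨R * ‖x‖, by rintro _ ⟨c, rfl⟩; exact hle c c.2 x⟩
  have hp : ∀ c ∈ K, ∀ x, RCLike.re (c x) ≤ p x := fun c hc x => le_ciSup (hbdd x) ⟨c, hc⟩
  have hpconv : ConvexOn ℝ univ p := by
    refine ⟨convex_univ, fun x _ y _ a b ha hb _ => ciSup_le fun c => ?_⟩
    have h1 : RCLike.re ((c : WeakDual 𝕜 X) (a • x + b • y)) =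
        a * RCLike.re ((c : WeakDual 𝕜 X) x) + b * RCLike.re ((c : WeakDual 𝕜 X) y) := by
      rw [map_add, ← algebraMap_smul 𝕜 a x, ← algebraMap_smul 𝕜 b y, map_smul, map_smul]
      simp
    rw [h1, smul_eq_mul, smul_eq_mul]
    gcongr
    · exact hp c c.2 x
    · exact hp c c.2 y
  have hplip : ∀ x y, p x ≤ p y + R * ‖x - y‖ := fun x y => ciSup_le fun c => by
    have h1 : (c : WeakDual 𝕜 X) x = (c : WeakDual 𝕜 X) y + (c : WeakDual 𝕜 X) (x - y) := by
      rw [← map_add, add_sub_cancel]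
    rw [h1, map_add]
    exact add_le_add (hp c c.2 y) (hle c c.2 _)
  have hpcont : Continuous p := by
    refine (LipschitzWith.of_dist_le_mul (K := R.toNNReal) fun x y => ?_).continuous
    rw [Real.coe_toNNReal _ hR, Real.dist_eq, dist_eq_norm, abs_le]
    have h1 := hplip x y
    have h2 := hplip y x
    rw [norm_sub_rev] at h2
    constructor <;> linarith
  obtain ⟨x, -, hx⟩ : {x ∈ (univ : Set X) | DifferentiableAt ℝ p x}.Nonempty :=
    closure_nonempty_iff.1
      ⟨0, hX univ p isOpen_univ convex_univ hpconv hpcont.continuousOn (mem_univ 0)⟩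
  obtain ⟨δ, hδ, hD⟩ := Metric.eventually_nhds_iff.1
    (hx.hasFDerivAt.isLittleO.def (show (0 : ℝ) < ε / 8 by positivity))
  set D := fderiv ℝ p x
  have hD' : ∀ h : X, ‖h‖ ≤ δ / 2 → p (x + h) ≤ p x + D h + ε / 8 * (δ / 2) := by
    intro h hh
    have h1 := hD (y := x + h) (by rw [dist_eq_norm, add_sub_cancel_left]; linarith)
    rw [add_sub_cancel_left, Real.norm_eq_abs] at h1
    have h2 := (abs_le.1 h1).2
    have h3 : ε / 8 * ‖h‖ ≤ ε / 8 * (δ / 2) := by gcongr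
    linarith
  set α := ε / 8 * (δ / 2) with hα
  have hα0 : 0 < α := by positivity
  refine ⟨{c | p x - α < RCLike.re (c x)}, ?_, ?_, ?_⟩
  · exact isOpen_lt continuous_const (RCLike.continuous_re.comp (WeakDual.eval_continuous x))
  · obtain ⟨c, hc⟩ := exists_lt_of_lt_ciSup (show p x - α < p x by linarith)
    exact ⟨c, hc, c.2⟩
  · rintro c ⟨hc, hcK⟩ d ⟨hd, hdK⟩
    refine norm_le_of_re_apply_le_on_ball hε.le (half_pos hδ) fun h hh => ?_
    have h1 := (hp c hcK (x + h)).trans (hD' h hh)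
    have h2 := (hp d hdK (x + -h)).trans (hD' (-h) (by rwa [norm_neg]))
    simp only [map_add, map_neg] at h1 h2
    change p x - α < RCLike.re (c x) at hc
    change p x - α < RCLike.re (d x) at hd
    have h3 : RCLike.re ((WeakDual.toStrongDual c - WeakDual.toStrongDual d) h) =
        RCLike.re (c h) - RCLike.re (d h) := by
      simp
    rw [h3]
    have h4 : ε * (δ / 2) = 8 * α := by rw [hα]; ring
    linarith

/-! ### Cantor trees: separable subspaces with separable duals -/

/-- If a bounded weak-star compact set `K` has no small relatively open subset, then a tree of
relatively open subsets can be built, together with countably many vectors of norm at most `1`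
which separate the branches uniformly. The span of these vectors has nonseparable dual. -/
theorem isDualFragmented_of_separable_duals
    (hX : ∀ V : Submodule 𝕜 X, TopologicalSpace.IsSeparable (V : Set X) →
      TopologicalSpace.SeparableSpace (StrongDual 𝕜 V)) : IsDualFragmented 𝕜 X := by
  intro R ε hε K hK hKne hKR
  by_contra! hcon
  let S := {O : Set (WeakDual 𝕜 X) // IsOpen O ∧ (O ∩ K).Nonempty}
  have hstep : ∀ O : S, ∃ (h : X) (O' : Bool → S), ‖h‖ ≤ 1 ∧ (∀ b, (O' b).1 ⊆ O.1) ∧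
      ∀ c ∈ closure (O' true).1, ∀ d ∈ closure (O' false).1,
        ε / 3 ≤ RCLike.re (c h) - RCLike.re (d h) := by
    intro ⟨O, hO, hOne⟩
    obtain ⟨c, hc, d, hd, hcd⟩ := hcon O hO hOne
    obtain ⟨h, hh, hlt⟩ : ∃ h : X, ‖h‖ ≤ 1 ∧ ε < RCLike.re (c h) - RCLike.re (d h) := by
      by_contra! hle
      refine hcd.not_ge (norm_le_of_re_apply_le_on_ball hε.le one_pos fun h hh => ?_)
      simpa using hle h hh
    have hev : Continuous fun e : WeakDual 𝕜 X => RCLike.re (e h) :=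
      RCLike.continuous_re.comp (WeakDual.eval_continuous h)
    -- with margins of `ε / 3`, the two half-spaces remain `ε / 3` apart after taking closures
    let O₁ := O ∩ {e | RCLike.re (c h) - ε / 3 < RCLike.re (e h)}
    let O₀ := O ∩ {e | RCLike.re (e h) < RCLike.re (d h) + ε / 3}
    have h1 : IsOpen O₁ := hO.inter (isOpen_lt continuous_const hev)
    have h0 : IsOpen O₀ := hO.inter (isOpen_lt hev continuous_const)
    have hc1 : c ∈ O₁ ∩ K := ⟨⟨hc.1, by simp [hε]⟩, hc.2⟩
    have hd0 : d ∈ O₀ ∩ K := ⟨⟨hd.1, by simp [hε]⟩, hd.2⟩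
    refine ⟨h, fun b => if b then ⟨O₁, h1, c, hc1⟩ else ⟨O₀, h0, d, hd0⟩, hh, ?_, ?_⟩
    · intro b
      cases b
      · exact inter_subset_left
      · exact inter_subset_left
    · intro a ha b hb
      have ha' : a ∈ {e : WeakDual 𝕜 X | RCLike.re (c h) - ε / 3 ≤ RCLike.re (e h)} :=
        closure_minimal (fun e he => le_of_lt he.2) (isClosed_le continuous_const hev) ha
      have hb' : b ∈ {e : WeakDual 𝕜 X | RCLike.re (e h) ≤ RCLike.re (d h) + ε / 3} :=
        closure_minimal (fun e he => le_of_lt he.2) (isClosed_le hev continuous_const) hb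
      simp only [mem_ofPred_eq] at ha' hb'
      linarith
  choose h O' hh hsub hsep using hstep
  let T : List Bool → S := fun l => List.rec ⟨univ, isOpen_univ, by simpa using hKne⟩
    (fun b _ O => O' O b) l
  have hT : ∀ b l, T (b :: l) = O' (T l) b := fun b l => rfl
  -- each branch of the tree contains a functional of `K`
  have hbranch : ∀ σ : ℕ → Bool, ∃ c, ∀ n, c ∈ closure (T (PiNat.res σ n)).1 := by
    intro σ
    obtain ⟨c, hc⟩ := IsCompact.nonempty_iInter_of_sequence_nonempty_isCompact_isClosed
      (fun n => closure (T (PiNat.res σ n)).1 ∩ K)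
      (fun n => inter_subset_inter_left _ (closure_mono (by
        rw [PiNat.res_succ, hT]; exact hsub _ _)))
      (fun n => (T (PiNat.res σ n)).2.2.mono (inter_subset_inter_left _ subset_closure))
      (hK.inter_left isClosed_closure)
      (fun n => isClosed_closure.inter hK.isClosed)
    exact ⟨c, fun n => (mem_iInter.1 hc n).1⟩
  choose z hz using hbranch
  let V : Submodule 𝕜 X := Submodule.span 𝕜 (range fun l => h (T l))
  have hVsep : TopologicalSpace.IsSeparable (V : Set X) :=
    (countable_range _).isSeparable.span
  have := hX V hVsep
  let r : (ℕ → Bool) → StrongDual 𝕜 V := fun σ => (WeakDual.toStrongDual (z σ)).comp V.subtypeL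
  have key : ∀ (σ τ : ℕ → Bool) (n : ℕ), PiNat.res σ n = PiNat.res τ n → σ n = true →
      τ n = false → ε / 3 ≤ dist (r σ) (r τ) := by
    intro σ τ n hn hσ hτ
    have h1 := hz σ (n + 1)
    have h2 := hz τ (n + 1)
    rw [PiNat.res_succ, hT, hσ] at h1
    rw [PiNat.res_succ, hT, hτ, ← hn] at h2
    have h3 := hsep _ _ h1 _ h2
    set w := h (T (PiNat.res σ n))
    have hw : w ∈ V := Submodule.subset_span (mem_range_self _)
    have h4 : ‖(r σ - r τ) ⟨w, hw⟩‖ ≤ ‖r σ - r τ‖ * ‖w‖ := (r σ - r τ).le_opNorm _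
    have h5 : RCLike.re ((r σ - r τ) ⟨w, hw⟩) = RCLike.re (z σ w) - RCLike.re (z τ w) := by
      simp [r]
    have h6 : ‖r σ - r τ‖ * ‖w‖ ≤ ‖r σ - r τ‖ * 1 := by gcongr; exact hh _
    rw [dist_eq_norm]
    linarith [RCLike.re_le_norm ((r σ - r τ) ⟨w, hw⟩)]
  have hpair : Pairwise fun σ τ => ε / 3 ≤ dist (r σ) (r τ) := by
    intro σ τ hne
    have hex : ∃ n, σ n ≠ τ n := Function.ne_iff.1 hne
    classical
    have hmin : PiNat.res σ (Nat.find hex) = PiNat.res τ (Nat.find hex) :=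
      PiNat.res_eq_res.2 fun m hm => not_not.1 (Nat.find_min hex hm)
    have hn := Nat.find_spec hex
    cases hσ : σ (Nat.find hex) <;> cases hτ : τ (Nat.find hex)
    · exact (hn (hσ.trans hτ.symm)).elim
    · rw [dist_comm]; exact key τ σ _ hmin.symm hτ hσ
    · exact key σ τ _ hmin hσ hτ
    · exact (hn (hσ.trans hτ.symm)).elim
  have hcount : (univ : Set (ℕ → Bool)).Countable := by
    refine Set.PairwiseDisjoint.countable_of_isOpen (s := fun σ => ball (r σ) (ε / 6)) ?_
      (fun σ _ => isOpen_ball) (fun σ _ => ⟨r σ, mem_ball_self (by positivity)⟩)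
    intro σ _ τ _ hne
    exact ball_disjoint_ball (by linarith [hpair hne])
  have : Countable (ℕ → Bool) := countable_univ_iff.1 hcount
  -- Cantor's diagonal argument
  obtain ⟨f, hf⟩ := exists_surjective_nat (ℕ → Bool)
  obtain ⟨n, hn⟩ := hf fun n => !f n n
  simpa using congrFun hn n

end AsplundToFragmented

/-! ### Fragmented duals: differentiability of convex functions -/

section Subgradient

variable {X : Type v} [NormedAddCommGroup X] [NormedSpace ℝ X]

/-- A continuous convex function on an open set has a subgradient at every point, by separating
the point of its graph from the open strict epigraph. -/
theorem ConvexOn.exists_subgradient {Ω : Set X} {f : X → ℝ} (hΩ : IsOpen Ω)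
    (hf : ConvexOn ℝ Ω f) (hc : ContinuousOn f Ω) {x : X} (hx : x ∈ Ω) :
    ∃ g : StrongDual ℝ X, ∀ y ∈ Ω, f x + g (y - x) ≤ f y := by
  have hS : IsOpen {p : X × ℝ | p.1 ∈ Ω ∧ f p.1 < p.2} := by
    have h1 : ContinuousOn (fun p : X × ℝ => p.2 - f p.1) (Prod.fst ⁻¹' Ω) :=
      continuousOn_snd.sub (hc.comp continuousOn_fst fun p hp => hp)
    convert h1.isOpen_inter_preimage (hΩ.preimage continuous_fst) (isOpen_Ioi (a := (0 : ℝ))) using 1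
    ext p
    simp
  obtain ⟨G, hG⟩ := geometric_hahn_banach_open_point hf.convex_strict_epigraph hS
    (x := (x, f x)) fun h => lt_irrefl _ h.2
  have hsplit : ∀ (y : X) (t : ℝ), G (y, t) = G (y, 0) + t * G (0, 1) := by
    intro y t
    have : ((y, t) : X × ℝ) = (y, 0) + t • (0, 1) := by simp
    rw [this, map_add, map_smul, smul_eq_mul]
  set a := G (0, 1)
  have ha : a < 0 := by
    have h1 := hG (x, f x + 1) ⟨hx, by simp⟩
    rw [hsplit, hsplit x (f x)] at h1
    linarith
  refine ⟨(-a)⁻¹ • G.comp (ContinuousLinearMap.inl ℝ X ℝ), fun y hy => ?_⟩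
  have h2 : G (y, 0) - G (x, 0) + a * (f y - f x) ≤ 0 := by
    refine le_of_forall_pos_le_add fun δ hδ => ?_
    have h1 := hG (y, f y + δ / (-a)) ⟨hy, by
      have : 0 < δ / (-a) := div_pos hδ (neg_pos.2 ha)
      simpa using this⟩
    rw [hsplit, hsplit x (f x)] at h1
    have h3 : δ / (-a) * a = -δ := by
      field_simp [ha.ne]
    nlinarith
  have h4 : ((-a)⁻¹ • G.comp (ContinuousLinearMap.inl ℝ X ℝ)) (y - x) =
      (G (y, 0) - G (x, 0)) / (-a) := by
    simp only [_root_.smul_apply, ContinuousLinearMap.comp_apply,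
      ContinuousLinearMap.inl_apply, map_sub, smul_eq_mul]
    ring
  rw [h4]
  have h5 : (G (y, 0) - G (x, 0)) / (-a) ≤ f y - f x := by
    rw [div_le_iff₀ (neg_pos.2 ha)]
    linarith
  linarith

end Subgradient

section FragmentedToAsplund

variable {𝕜 : Type u} [RCLike 𝕜] {X : Type v} [NormedAddCommGroup X] [NormedSpace 𝕜 X]

/-- The subgradients of `f` at `x`, relative to the set `U`, of norm at most `L`. Over `ℂ` the
subgradients are the complex functionals whose real parts are subgradients. -/
def boundedSubgradients (𝕜 : Type u) [RCLike 𝕜] {X : Type v} [NormedAddCommGroup X]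
    [NormedSpace 𝕜 X] (U : Set X) (f : X → ℝ) (L : ℝ) (x : X) : Set (WeakDual 𝕜 X) :=
  {c ∈ dualBall 𝕜 X L | ∀ y ∈ U, f x + RCLike.re (c (y - x)) ≤ f y}

theorem isCompact_boundedSubgradients (U : Set X) (f : X → ℝ) (L : ℝ) (x : X) :
    IsCompact (boundedSubgradients 𝕜 U f L x) := by
  have h : boundedSubgradients 𝕜 U f L x = dualBall 𝕜 X L ∩
      ⋂ y ∈ U, {c : WeakDual 𝕜 X | f x + RCLike.re (c (y - x)) ≤ f y} := by
    ext c
    simp [boundedSubgradients]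
  rw [h]
  refine (isCompact_dualBall L).inter_right (isClosed_biInter fun y _ => isClosed_le ?_ ?_)
  · exact continuous_const.add (RCLike.continuous_re.comp (WeakDual.eval_continuous _))
  · exact continuous_const

/-- Upper semicontinuity of the subdifferential: a weak-star compact set of functionals which
contains no subgradient at `x` contains none at nearby points either. -/
theorem eventually_boundedSubgradients_disjoint {U : Set X} {f : X → ℝ} {L : ℝ} {x : X}
    (hfx : ContinuousAt f x) {K : Set (WeakDual 𝕜 X)} (hK : IsCompact K)
    (hKL : K ⊆ dualBall 𝕜 X L) (hx : ∀ c ∈ K, c ∉ boundedSubgradients 𝕜 U f L x) :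
    ∀ᶠ x' in 𝓝 x, ∀ c ∈ K, c ∉ boundedSubgradients 𝕜 U f L x' := by
  refine hK.eventually_forall_of_forall_eventually fun c hc => ?_
  obtain ⟨y, hy, hlt⟩ : ∃ y ∈ U, f y < f x + RCLike.re (c (y - x)) := by
    by_contra! hle
    exact hx c hc ⟨hKL hc, hle⟩
  -- replacing `y - x'` by `y - x` costs `L * ‖x - x'‖` on the ball and makes the bound continuous
  have hcont : ContinuousAt (fun z : X × WeakDual 𝕜 X =>
      f z.1 + RCLike.re (z.2 (y - x)) - L * ‖x - z.1‖) (x, c) := by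
    refine ContinuousAt.sub (ContinuousAt.add ?_ ?_) ?_
    · exact ContinuousAt.comp (f := Prod.fst) (x := (x, c)) hfx continuousAt_fst
    · exact (RCLike.continuous_re.comp
        ((WeakDual.eval_continuous (y - x)).comp continuous_snd)).continuousAt
    · exact (continuous_const.mul (continuous_const.sub continuous_fst).norm).continuousAt
  have hev := hcont.eventually_const_lt (show f y < f x + RCLike.re (c (y - x)) - L * ‖x - x‖ by
    simpa using hlt)
  filter_upwards [hev] with ⟨x', d⟩ h hd
  have h1 := hd.2 y hy
  have h2 : RCLike.re (d (y - x')) = RCLike.re (d (y - x)) + RCLike.re (d (x - x')) := by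
    rw [← map_add, ← map_add, sub_add_sub_cancel]
  have h3 : |RCLike.re (d (x - x'))| ≤ L * ‖x - x'‖ :=
    (RCLike.abs_re_le_norm _).trans (norm_apply_le_of_mem_dualBall hd.1 _)
  have h4 := (abs_le.1 h3).1
  simp only at h h1
  linarith

variable [NormedSpace ℝ X] [IsScalarTower ℝ 𝕜 X]

theorem boundedSubgradients_nonempty {U : Set X} {f : X → ℝ} {L : NNReal} (hU : IsOpen U)
    (hf : ConvexOn ℝ U f) (hL : LipschitzOnWith L f U) {x : X} (hx : x ∈ U) :
    (boundedSubgradients 𝕜 U f L x).Nonempty := by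
  obtain ⟨g, hg⟩ := hf.exists_subgradient hU hL.continuousOn hx
  obtain ⟨δ, hδ, hball⟩ := Metric.isOpen_iff.1 hU x hx
  refine ⟨StrongDual.toWeakDual (g.extendRCLike : StrongDual 𝕜 X), ?_, fun y hy => ?_⟩
  · rw [mem_dualBall]
    refine norm_le_of_re_apply_le_on_ball L.2 (half_pos hδ) fun h hh => ?_
    have h1 : x + h ∈ U := hball (by rw [mem_ball, dist_eq_norm, add_sub_cancel_left]; linarith)
    have h2 := hg _ h1
    have h3 := hL.dist_le_mul _ h1 _ hx
    rw [Real.dist_eq, dist_eq_norm, add_sub_cancel_left] at h3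
    rw [add_sub_cancel_left] at h2
    have h4 : RCLike.re ((g.extendRCLike : StrongDual 𝕜 X) h) = g h := by simp
    change RCLike.re ((g.extendRCLike : StrongDual 𝕜 X) h) ≤ _
    rw [h4]
    have h5 : (L : ℝ) * ‖h‖ ≤ L * (δ / 2) := by gcongr
    have h6 := le_abs_self (f (x + h) - f x)
    change _ ≤ (L : ℝ) * _
    linarith
  · have h4 : RCLike.re ((g.extendRCLike : StrongDual 𝕜 X) (y - x)) = g (y - x) := by simp
    change f x + RCLike.re ((g.extendRCLike : StrongDual 𝕜 X) (y - x)) ≤ f y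
    rw [h4]
    exact hg y hy

/-- Where the maximal rank of the subgradients is minimal it is locally constant, so that the
subgradients of maximal rank are within `ε` of each other. Hence `f` is linear up to an
`ε`-Lipschitz error on some ball inside `U`. -/
theorem IsDualFragmented.exists_ball_almost_linear (hX : IsDualFragmented 𝕜 X) {U : Set X}
    {f : X → ℝ} {L : NNReal} (hU : IsOpen U) (hne : U.Nonempty) (hf : ConvexOn ℝ U f)
    (hL : LipschitzOnWith L f U) {ε : ℝ} (hε : 0 < ε) :
    ∃ x ∈ U, ∃ g : StrongDual ℝ X, ∃ r > 0, ∀ y ∈ ball x r, ∀ z ∈ ball x r,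
      |f y - f z - g (y - z)| ≤ ε * ‖y - z‖ := by
  obtain ⟨ρ, hρc, hρd⟩ := hX.exists_rank L hε
  let H := boundedSubgradients 𝕜 U f L
  have hmax : ∀ x ∈ U, ∃ c ∈ H x, ∀ d ∈ H x, ρ d ≤ ρ c := fun x hx =>
    exists_max_rank hρc (isCompact_boundedSubgradients U f L x)
      (boundedSubgradients_nonempty hU hf hL hx) fun c hc => hc.1
  -- the least element of `S` is the minimum over `U` of the maximal rank of a subgradient
  let S := {ξ | ∃ x ∈ U, ∀ c ∈ H x, ρ c ≤ ξ}
  have hS : S.Nonempty := by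
    obtain ⟨x, hx⟩ := hne
    obtain ⟨c, -, hc⟩ := hmax x hx
    exact ⟨ρ c, x, hx, hc⟩
  obtain ⟨x, hxU, hx⟩ := csInf_mem hS
  set ξ := sInf S
  have hev := eventually_boundedSubgradients_disjoint (U := U) (f := f) (L := L) (x := x)
    (hL.continuousOn.continuousAt (hU.mem_nhds hxU)) (hρc (Order.succ ξ)) (fun c hc => hc.1)
    (fun c hc hcx => absurd (hx c hcx) (not_le.2 (Order.succ_le_iff.1 hc.2)))
  obtain ⟨r, hr, hball⟩ := Metric.eventually_nhds_iff_ball.1 (hev.and (hU.mem_nhds hxU))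
  have hsel : ∀ y ∈ ball x r, ∃ c ∈ H y, ρ c = ξ := by
    intro y hy
    obtain ⟨h1, h2⟩ := hball y hy
    obtain ⟨c, hc, hcm⟩ := hmax y h2
    refine ⟨c, hc, le_antisymm ?_ (csInf_le' ⟨y, h2, hcm⟩)⟩
    by_contra hlt
    exact h1 c ⟨hc.1, Order.succ_le_iff.2 (not_le.1 hlt)⟩ hc
  obtain ⟨c, hc, hcξ⟩ := hsel x (mem_ball_self hr)
  let g : StrongDual ℝ X :=
    RCLike.reCLM.comp ((WeakDual.toStrongDual c).restrictScalars ℝ)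
  have hg : ∀ h, g h = RCLike.re (c h) := fun h => rfl
  have key : ∀ y ∈ ball x r, ∀ z ∈ ball x r, g (y - z) - ε * ‖y - z‖ ≤ f y - f z := by
    intro y hy z hz
    obtain ⟨d, hd, hdξ⟩ := hsel z hz
    have h1 := hd.2 y (hball y hy).2
    have h2 := (WeakDual.toStrongDual c - WeakDual.toStrongDual d).le_of_opNorm_le
      (hρd c hc.1 d hd.1 (hcξ.trans hdξ.symm)) (y - z)
    have h3 : RCLike.re ((WeakDual.toStrongDual c - WeakDual.toStrongDual d) (y - z)) =
        RCLike.re (c (y - z)) - RCLike.re (d (y - z)) := by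
      simp
    have h4 := (RCLike.re_le_norm _).trans h2
    rw [hg]
    linarith
  refine ⟨x, hxU, g, r, hr, fun y hy z hz => abs_le.2 ⟨?_, ?_⟩⟩
  · linarith [key y hy z hz]
  · have h1 := key z hz y hy
    have h2 : g (z - y) = - g (y - z) := by rw [← map_neg, neg_sub]
    rw [h2, norm_sub_rev] at h1
    linarith

/-- If a convex function is linear near `x` up to `ε`-Lipschitz errors for every `ε`, then it is
Fréchet differentiable at `x`, with any subgradient as its derivative. -/
theorem differentiableAt_of_almost_linear {X : Type v} [NormedAddCommGroup X] [NormedSpace ℝ X]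
    {Ω : Set X} {f : X → ℝ} (hΩ : IsOpen Ω) (hf : ConvexOn ℝ Ω f) (hc : ContinuousOn f Ω) {x : X}
    (hx : x ∈ Ω) (h : ∀ ε > 0, ∃ g : StrongDual ℝ X, ∀ᶠ y in 𝓝 x,
      |f y - f x - g (y - x)| ≤ ε * ‖y - x‖) : DifferentiableAt ℝ f x := by
  obtain ⟨g, hg⟩ := hf.exists_subgradient hΩ hc hx
  refine HasFDerivAt.differentiableAt (f' := g) (.of_isLittleO ?_)
  refine Asymptotics.IsLittleO.of_bound fun ε hε => ?_
  obtain ⟨d, hd⟩ := h (ε / 2) (half_pos hε)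
  obtain ⟨δ, hδ, hball⟩ := Metric.eventually_nhds_iff_ball.1 (hd.and (hΩ.mem_nhds hx))
  have hgd : ‖g - d‖ ≤ ε / 2 := by
    refine norm_le_of_re_apply_le_on_ball (half_pos hε).le (half_pos hδ) fun k hk => ?_
    obtain ⟨h1, h2⟩ := hball (x + k) (by
      rw [mem_ball, dist_eq_norm, add_sub_cancel_left]; linarith)
    have h3 := hg _ h2
    rw [add_sub_cancel_left] at h1 h3
    have h4 := (abs_le.1 h1).2
    have h5 : ε / 2 * ‖k‖ ≤ ε / 2 * (δ / 2) := by gcongr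
    simp only [_root_.sub_apply, RCLike.re_to_real]
    linarith
  filter_upwards [hd] with y hy
  have h1 := (g - d).le_of_opNorm_le hgd (y - x)
  have h2 : f y - f x - g (y - x) = (f y - f x - d (y - x)) - (g - d) (y - x) := by
    simp only [_root_.sub_apply]
    ring
  rw [h2]
  refine (norm_sub_le _ _).trans ?_
  rw [Real.norm_eq_abs (f y - f x - d (y - x))]
  linarith

/-- The points near which a convex function is linear up to `ε`-Lipschitz errors form an open
dense set for each `ε`, and the function is differentiable at the points common to all of them. -/
theorem IsDualFragmented.isRealAsplund [CompleteSpace X] (hX : IsDualFragmented 𝕜 X) :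
    IsRealAsplund X := by
  intro Ω f hΩ hconv hf hc x₀ hx₀
  let G : ℕ → Set X := fun n => {x | ∃ g : StrongDual ℝ X, ∃ r > 0, ∀ y ∈ ball x r,
    ∀ z ∈ ball x r, |f y - f z - g (y - z)| ≤ 1 / (n + 1 : ℝ) * ‖y - z‖}
  have hGo : ∀ n, IsOpen (G n) := by
    intro n
    refine Metric.isOpen_iff.2 fun x ⟨g, r, hr, h⟩ => ⟨r / 2, half_pos hr, fun x' hx' => ?_⟩
    have hsub : ball x' (r / 2) ⊆ ball x r :=
      ball_subset_ball' (by linarith [mem_ball.1 hx'])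
    exact ⟨g, r / 2, half_pos hr, fun y hy z hz => h y (hsub hy) z (hsub hz)⟩
  have hGd : ∀ n, Ω ⊆ closure (G n) := by
    intro n x hx
    refine mem_closure_iff_nhds.2 fun N hN => ?_
    obtain ⟨L, t, ht, hL⟩ := (hf.locallyLipschitzOn_iff_continuousOn hΩ).2 hc hx
    rw [hΩ.nhdsWithin_eq hx] at ht
    obtain ⟨r, hr, hball⟩ := Metric.mem_nhds_iff.1 (inter_mem (inter_mem ht hN) (hΩ.mem_nhds hx))
    obtain ⟨x', hx', h⟩ := hX.exists_ball_almost_linear isOpen_ball ⟨x, mem_ball_self hr⟩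
      (hf.subset (fun y hy => (hball hy).2) (convex_ball x r))
      (hL.mono fun y hy => (hball hy).1.1) (show (0 : ℝ) < 1 / (n + 1 : ℝ) by positivity)
    exact ⟨x', (hball hx').1.2, h⟩
  have hdense : Dense (⋂ n, (G n ∪ (closure Ω)ᶜ)) := by
    refine dense_iInter_of_isOpen (fun n => (hGo n).union isClosed_closure.isOpen_compl)
      fun n x => ?_
    by_cases hx : x ∈ closure Ω
    · exact closure_mono subset_union_left (closure_minimal (hGd n) isClosed_closure hx)
    · exact subset_closure (Or.inr hx)
  refine mem_closure_iff_nhds.2 fun N hN => ?_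
  obtain ⟨x, ⟨hxN, hxΩ⟩, hx⟩ := mem_closure_iff_nhds.1 (hdense x₀) _
    (inter_mem hN (hΩ.mem_nhds hx₀))
  refine ⟨x, hxN, hxΩ, differentiableAt_of_almost_linear hΩ hf hc hxΩ fun ε hε => ?_⟩
  obtain ⟨n, hn⟩ := exists_nat_one_div_lt hε
  obtain ⟨g, r, hr, h⟩ := ((mem_iInter.1 hx n).resolve_right fun h => h (subset_closure hxΩ))
  refine ⟨g, Metric.eventually_nhds_iff_ball.2 ⟨r, hr, fun y hy => ?_⟩⟩
  exact (h y hy x (mem_ball_self hr)).trans (by gcongr)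

end FragmentedToAsplund

/-! ### Fragmented duals: the rich family of rectangles -/

/-- A closed subspace whose distance to every point of the unit ball is at most `1 / 2` is the
whole space, by Riesz's lemma. -/
theorem Submodule.eq_top_of_half_dense {𝕜 : Type*} [RCLike 𝕜] {E : Type*} [NormedAddCommGroup E]
    [NormedSpace 𝕜 E] {W : Submodule 𝕜 E} (hW : IsClosed (W : Set E))
    (h : ∀ x : E, ‖x‖ ≤ 1 → ∃ w ∈ W, ‖x - w‖ ≤ 1 / 2) : W = ⊤ := by
  by_contra hne
  obtain ⟨x, -, hx⟩ := SetLike.exists_of_lt (lt_top_iff_ne_top.2 hne)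
  obtain ⟨z, hz, hzW⟩ := riesz_lemma hW ⟨x, hx⟩ (show (3 / 4 : ℝ) < 1 by norm_num)
  have hz0 : z ≠ 0 := fun h => hz (h ▸ W.zero_mem)
  have hn : 0 < ‖z‖ := norm_pos_iff.2 hz0
  have hn' : ((‖z‖ : ℝ) : 𝕜) ≠ 0 := by exact_mod_cast hn.ne'
  obtain ⟨w, hw, hwz⟩ := h (((‖z‖ : ℝ) : 𝕜)⁻¹ • z) (by
    rw [norm_smul, norm_inv, RCLike.norm_ofReal, abs_norm, inv_mul_cancel₀ hn.ne'])
  have h1 := hzW (((‖z‖ : ℝ) : 𝕜) • w) (W.smul_mem _ hw)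
  have h2 : z - ((‖z‖ : ℝ) : 𝕜) • w = ((‖z‖ : ℝ) : 𝕜) • (((‖z‖ : ℝ) : 𝕜)⁻¹ • z - w) := by
    rw [smul_sub, smul_inv_smul₀ hn']
  rw [h2, norm_smul, RCLike.norm_ofReal, abs_norm] at h1
  nlinarith

theorem Submodule.iSup_prod {R M N ι : Type*} [Semiring R] [AddCommMonoid M] [AddCommMonoid N]
    [Module R M] [Module R N] (V : ι → Submodule R M) (Y : ι → Submodule R N) :
    ⨆ i, (V i).prod (Y i) = (⨆ i, V i).prod (⨆ i, Y i) := by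
  refine le_antisymm (iSup_le fun i => Submodule.prod_mono (le_iSup V i) (le_iSup Y i)) ?_
  rintro ⟨x, y⟩ ⟨hx, hy⟩
  have h1 : ⨆ i, V i ≤ (⨆ i, (V i).prod (Y i)).comap (LinearMap.inl R M N) :=
    iSup_le fun i v hv => le_iSup (fun i => (V i).prod (Y i)) i ⟨hv, (Y i).zero_mem⟩
  have h2 : ⨆ i, Y i ≤ (⨆ i, (V i).prod (Y i)).comap (LinearMap.inr R M N) :=
    iSup_le fun i v hv => le_iSup (fun i => (V i).prod (Y i)) i ⟨(V i).zero_mem, hv⟩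
  have h3 : (x, 0) ∈ ⨆ i, (V i).prod (Y i) := h1 hx
  have h4 : (0, y) ∈ ⨆ i, (V i).prod (Y i) := h2 hy
  simpa using add_mem h3 h4

theorem Submodule.prod_le_prod_iff {R M N : Type*} [Semiring R] [AddCommMonoid M] [AddCommMonoid N]
    [Module R M] [Module R N] {V V' : Submodule R M} {Y Y' : Submodule R N} :
    V.prod Y ≤ V'.prod Y' ↔ V ≤ V' ∧ Y ≤ Y' :=
  ⟨fun h => ⟨fun v hv => (h (show (v, 0) ∈ V.prod Y from ⟨hv, Y.zero_mem⟩)).1,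
    fun y hy => (h (show (0, y) ∈ V.prod Y from ⟨V.zero_mem, hy⟩)).2⟩,
    fun h => Submodule.prod_mono h.1 h.2⟩

section RichFamily

variable {𝕜 : Type u} [RCLike 𝕜] {X : Type v} [NormedAddCommGroup X] [NormedSpace 𝕜 X]

theorem closedSpan_mem_closedSeparableSubspaces {C : Set X} (hC : TopologicalSpace.IsSeparable C) :
    (Submodule.span 𝕜 C).topologicalClosure ∈ closedSeparableSubspaces 𝕜 X :=
  ⟨Submodule.isClosed_topologicalClosure _, hC.span.closure⟩

theorem subset_closedSpan (C : Set X) : C ⊆ (Submodule.span 𝕜 C).topologicalClosure :=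
  Submodule.subset_span.trans (Submodule.le_topologicalClosure _)

theorem closedIUnion_mem_closedSeparableSubspaces {V : ℕ → Submodule 𝕜 X} (hV : Monotone V)
    (h : ∀ n, V n ∈ closedSeparableSubspaces 𝕜 X) :
    (⨆ n, V n).topologicalClosure ∈ closedSeparableSubspaces 𝕜 X := by
  refine ⟨Submodule.isClosed_topologicalClosure _, ?_⟩
  rw [Submodule.topologicalClosure_coe, Submodule.coe_iSup_of_directed V hV.directed_le]
  exact (TopologicalSpace.IsSeparable.iUnion fun n => (h n).2).closure

theorem isometry_restrictToSubspace_iff {V : Submodule 𝕜 X} {Y : Submodule 𝕜 (StrongDual 𝕜 X)} :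
    Isometry (restrictToSubspace V Y) ↔ ∀ y ∈ Y, ‖y‖ ≤ ‖y.comp V.subtypeL‖ := by
  constructor
  · intro h y hy
    have h1 := h.dist_eq ⟨y, hy⟩ 0
    have h2 : restrictToSubspace V Y 0 = 0 := by
      ext v
      simp [restrictToSubspace]
    rw [h2, dist_zero_right] at h1
    have h3 : dist (⟨y, hy⟩ : Y) 0 = ‖y‖ := dist_zero_right y
    exact (h3.symm.trans h1.symm).le
  · refine fun h => Isometry.of_dist_eq fun a b => ?_
    have h1 : restrictToSubspace V Y a - restrictToSubspace V Y b =
        ((a - b : Y) : StrongDual 𝕜 X).comp V.subtypeL := by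
      ext v
      simp [restrictToSubspace]
    have h2 : dist a b = ‖((a - b : Y) : StrongDual 𝕜 X)‖ :=
      dist_eq_norm (a : StrongDual 𝕜 X) b
    rw [h2, dist_eq_norm, h1]
    refine le_antisymm (ContinuousLinearMap.opNorm_le_bound _ (norm_nonneg _) fun v => ?_)
      (h _ (a - b).2)
    exact ((a - b : Y) : StrongDual 𝕜 X).le_opNorm v

/-- The ranks visible on `V`: those values of `ρ` on the dual unit ball which are maximal among
all functionals of the ball with a given restriction to `V`. -/
def visibleRanks (ρ : WeakDual 𝕜 X → Ordinal.{max u v}) (V : Submodule 𝕜 X) :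
    Set Ordinal.{max u v} :=
  {ξ | ∃ x ∈ dualBall 𝕜 X 1, ρ x = ξ ∧
    ∀ y ∈ dualBall 𝕜 X 1, (∀ v ∈ V, y v = x v) → ρ y ≤ ξ}

/-- The closed span of the representatives `c ξ` of the ranks `ξ` visible on `V`. -/
def visibleDual (ρ : WeakDual 𝕜 X → Ordinal.{max u v}) (c : Ordinal.{max u v} → StrongDual 𝕜 X)
    (V : Submodule 𝕜 X) : Submodule 𝕜 (StrongDual 𝕜 X) :=
  (Submodule.span 𝕜 (c '' visibleRanks ρ V)).topologicalClosure

variable {ρ : WeakDual 𝕜 X → Ordinal.{max u v}} {c : Ordinal.{max u v} → StrongDual 𝕜 X}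

theorem visibleRanks_mono {V W : Submodule 𝕜 X} (h : V ≤ W) :
    visibleRanks ρ V ⊆ visibleRanks ρ W := by
  rintro ξ ⟨x, hx, hξ, hmax⟩
  exact ⟨x, hx, hξ, fun y hy hyx => hmax y hy fun v hv => hyx v (h hv)⟩

theorem eq_on_closure_of_eq_on {S : Set X} {x y : WeakDual 𝕜 X} (h : ∀ v ∈ S, y v = x v) :
    ∀ v ∈ closure S, y v = x v :=
  closure_minimal (t := {v | y v = x v}) h
    (isClosed_eq (WeakDual.toStrongDual y).continuous (WeakDual.toStrongDual x).continuous)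

theorem visibleRanks_topologicalClosure (V : Submodule 𝕜 X) :
    visibleRanks ρ V.topologicalClosure = visibleRanks ρ V := by
  refine Subset.antisymm ?_ (visibleRanks_mono V.le_topologicalClosure)
  rintro ξ ⟨x, hx, hξ, hmax⟩
  exact ⟨x, hx, hξ, fun y hy hyx => hmax y hy (eq_on_closure_of_eq_on hyx)⟩

theorem isCompact_agreeing (x : WeakDual 𝕜 X) (S : Set X) {K : Set (WeakDual 𝕜 X)}
    (hK : IsCompact K) : IsCompact (K ∩ {y | ∀ v ∈ S, y v = x v}) := by
  have h : {y : WeakDual 𝕜 X | ∀ v ∈ S, y v = x v} = ⋂ v ∈ S, {y | y v = x v} := by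
    ext y
    simp
  rw [h]
  exact hK.inter_right (isClosed_biInter fun v _ =>
    isClosed_eq (WeakDual.eval_continuous v) continuous_const)

/-- A rank visible on a directed union is visible on one of its members, by compactness. -/
theorem visibleRanks_iSup_subset {ι : Type*} [Nonempty ι] {V : ι → Submodule 𝕜 X}
    (hV : Directed (· ≤ ·) V) (hρ : ∀ ξ, IsCompact {x ∈ dualBall 𝕜 X 1 | ξ ≤ ρ x}) :
    visibleRanks ρ (⨆ i, V i) ⊆ ⋃ i, visibleRanks ρ (V i) := by
  rintro ξ ⟨x, hx, hξ, hmax⟩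
  by_contra hcon
  have h1 : ∀ i, ∃ y ∈ dualBall 𝕜 X 1, (∀ v ∈ V i, y v = x v) ∧ ξ < ρ y := by
    intro i
    by_contra! hle
    exact hcon (mem_iUnion.2 ⟨i, x, hx, hξ, hle⟩)
  have hcomp := fun i => isCompact_agreeing x (V i : Set X) (hρ (Order.succ ξ))
  obtain ⟨y, hy⟩ := IsCompact.nonempty_iInter_of_directed_nonempty_isCompact_isClosed
    (fun i => {y ∈ dualBall 𝕜 X 1 | Order.succ ξ ≤ ρ y} ∩ {y | ∀ v ∈ V i, y v = x v})
    (fun i j => by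
      obtain ⟨k, hik, hjk⟩ := hV i j
      exact ⟨k, fun y hy => ⟨hy.1, fun v hv => hy.2 v (hik hv)⟩,
        fun y hy => ⟨hy.1, fun v hv => hy.2 v (hjk hv)⟩⟩)
    (fun i => by
      obtain ⟨y, hyB, hyV, hlt⟩ := h1 i
      exact ⟨y, ⟨hyB, Order.succ_le_iff.2 hlt⟩, hyV⟩)
    hcomp (fun i => (hcomp i).isClosed)
  rw [mem_iInter] at hy
  obtain ⟨⟨hyB, hlt⟩, -⟩ := hy (Classical.arbitrary ι)
  refine absurd (hmax y hyB fun v hv => ?_) (not_le.2 (Order.succ_le_iff.1 hlt))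
  obtain ⟨i, hi⟩ := (Submodule.mem_iSup_of_directed V hV).1 hv
  exact (hy i).2 v hi

/-- Only countably many ranks are visible on a separable subspace: to distinct visible ranks
correspond distinct members of a countable basis of the weak-star topology of the dual ball of
the subspace, realised here inside a countable product of copies of `𝕜`. -/
theorem countable_visibleRanks {V : Submodule 𝕜 X} (hV : TopologicalSpace.IsSeparable (V : Set X))
    (hρ : ∀ ξ, IsCompact {x ∈ dualBall 𝕜 X 1 | ξ ≤ ρ x}) : (visibleRanks ρ V).Countable := by
  obtain ⟨t, -, htc, hVt⟩ := hV.exists_countable_dense_subset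
  have : Countable t := htc.to_subtype
  let r : WeakDual 𝕜 X → t → 𝕜 := fun x v => x v
  have hr : Continuous r := continuous_pi fun v => WeakDual.eval_continuous _
  have hex : ∀ ξ ∈ visibleRanks ρ V, ∃ W ∈ TopologicalSpace.countableBasis (t → 𝕜),
      (∃ x ∈ dualBall 𝕜 X 1, ρ x = ξ ∧ r x ∈ W) ∧
      ∀ y ∈ dualBall 𝕜 X 1, ξ < ρ y → r y ∉ W := by
    rintro ξ ⟨x, hx, hξ, hmax⟩
    have hcl : IsClosed (r '' {y ∈ dualBall 𝕜 X 1 | Order.succ ξ ≤ ρ y}) :=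
      ((hρ _).image hr).isClosed
    have hxr : r x ∈ (r '' {y ∈ dualBall 𝕜 X 1 | Order.succ ξ ≤ ρ y})ᶜ := by
      rintro ⟨y, ⟨hyB, hy⟩, hyx⟩
      refine absurd (hmax y hyB fun v hv => ?_) (not_le.2 (Order.succ_le_iff.1 hy))
      exact eq_on_closure_of_eq_on (fun v hv => congrFun hyx ⟨v, hv⟩) v (hVt hv)
    obtain ⟨W, hW, hxW, hWs⟩ := (TopologicalSpace.isBasis_countableBasis
      (t → 𝕜)).exists_subset_of_mem_open hxr hcl.isOpen_compl
    exact ⟨W, hW, ⟨x, hx, hξ, hxW⟩, fun y hyB hy hyW =>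
      hWs hyW ⟨y, ⟨hyB, Order.succ_le_iff.2 hy⟩, rfl⟩⟩
  choose! W hWb hWin hWout using hex
  have hne : ∀ ξ ∈ visibleRanks ρ V, ∀ η ∈ visibleRanks ρ V, ξ < η → W ξ ≠ W η := by
    intro ξ hξ η hη hlt heq
    obtain ⟨x, hx, hxη, hxW⟩ := hWin η hη
    exact hWout ξ hξ x hx (hxη ▸ hlt) (heq ▸ hxW)
  refine MapsTo.countable_of_injOn (f := W) hWb (fun ξ hξ η hη h => ?_)
    (TopologicalSpace.countable_countableBasis _)
  rcases lt_trichotomy ξ η with h' | h' | h'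
  · exact (hne _ hξ _ hη h' h).elim
  · exact h'
  · exact (hne _ hη _ hξ h' h.symm).elim

theorem isClosed_visibleDual (V : Submodule 𝕜 X) :
    IsClosed (visibleDual ρ c V : Set (StrongDual 𝕜 X)) :=
  Submodule.isClosed_topologicalClosure _

theorem visibleDual_mono {V W : Submodule 𝕜 X} (h : V ≤ W) :
    visibleDual ρ c V ≤ visibleDual ρ c W :=
  Submodule.topologicalClosure_mono (Submodule.span_mono (image_mono (visibleRanks_mono h)))

theorem apply_mem_visibleDual {V : Submodule 𝕜 X} {ξ : Ordinal.{max u v}}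
    (hξ : ξ ∈ visibleRanks ρ V) : c ξ ∈ visibleDual ρ c V :=
  subset_closedSpan _ (mem_image_of_mem c hξ)

theorem visibleDual_mem_closedSeparableSubspaces {V : Submodule 𝕜 X}
    (hV : TopologicalSpace.IsSeparable (V : Set X))
    (hρ : ∀ ξ, IsCompact {x ∈ dualBall 𝕜 X 1 | ξ ≤ ρ x}) :
    visibleDual ρ c V ∈ closedSeparableSubspaces 𝕜 (StrongDual 𝕜 X) :=
  closedSpan_mem_closedSeparableSubspaces ((countable_visibleRanks hV hρ).image c).isSeparable

theorem visibleDual_closure_iSup {ι : Type*} [Nonempty ι] {V : ι → Submodule 𝕜 X}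
    (hV : Directed (· ≤ ·) V) (hρ : ∀ ξ, IsCompact {x ∈ dualBall 𝕜 X 1 | ξ ≤ ρ x}) :
    visibleDual ρ c (⨆ i, V i).topologicalClosure =
      (⨆ i, visibleDual ρ c (V i)).topologicalClosure := by
  refine le_antisymm (Submodule.topologicalClosure_mono (Submodule.span_le.2 ?_))
    (Submodule.topologicalClosure_minimal _ (iSup_le fun i => visibleDual_mono
      ((le_iSup V i).trans (Submodule.le_topologicalClosure _))) (isClosed_visibleDual _))
  rintro _ ⟨ξ, hξ, rfl⟩
  rw [visibleRanks_topologicalClosure] at hξ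
  obtain ⟨i, hi⟩ := mem_iUnion.1 (visibleRanks_iSup_subset hV hρ hξ)
  exact le_iSup (fun i => visibleDual ρ c (V i)) i (apply_mem_visibleDual hi)

theorem directed_visibleDual {ι : Type*} {V : ι → Submodule 𝕜 X} (hV : Directed (· ≤ ·) V) :
    Directed (· ≤ ·) fun i => visibleDual ρ c (V i) := fun i j =>
  let ⟨k, hik, hjk⟩ := hV i j
  ⟨k, visibleDual_mono hik, visibleDual_mono hjk⟩

/-- Among the extensions in the dual unit ball of a functional of norm at most `1` on `V`, one of maximal rank shows that
the functional is within `1 / 2` of the restriction of a representative. -/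
theorem exists_visibleRank_near (hρ : ∀ ξ, IsCompact {x ∈ dualBall 𝕜 X 1 | ξ ≤ ρ x})
    (hc : ∀ x ∈ dualBall 𝕜 X 1, ‖WeakDual.toStrongDual x - c (ρ x)‖ ≤ 1 / 2)
    (V : Submodule 𝕜 X) (f : StrongDual 𝕜 V) (hf : ‖f‖ ≤ 1) :
    ∃ ξ ∈ visibleRanks ρ V, ‖f - (c ξ).comp V.subtypeL‖ ≤ 1 / 2 := by
  obtain ⟨g, hgf, hg⟩ := exists_extension_norm_eq V f
  obtain ⟨x, ⟨hxB, hxg⟩, hmax⟩ := exists_max_rank hρ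
    (isCompact_agreeing (StrongDual.toWeakDual g) (V : Set X) (isCompact_dualBall 1))
    ⟨StrongDual.toWeakDual g, mem_dualBall.2 (hg.trans_le hf), fun _ _ => rfl⟩ inter_subset_left
  refine ⟨ρ x, ⟨x, hxB, rfl, fun y hy hyx =>
    hmax y ⟨hy, fun v hv => (hyx v hv).trans (hxg v hv)⟩⟩, ?_⟩
  refine ContinuousLinearMap.opNorm_le_bound _ (by norm_num) fun v => ?_
  have h1 : (f - (c (ρ x)).comp V.subtypeL) v = (WeakDual.toStrongDual x - c (ρ x)) v := by
    have : WeakDual.toStrongDual x (v : X) = f v := (hxg v v.2).trans (hgf v)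
    simp [this]
  rw [h1]
  exact ContinuousLinearMap.le_of_opNorm_le _ (hc x hxB) v

theorem surjective_restrictToSubspace_visibleDual
    (hρ : ∀ ξ, IsCompact {x ∈ dualBall 𝕜 X 1 | ξ ≤ ρ x})
    (hc : ∀ x ∈ dualBall 𝕜 X 1, ‖WeakDual.toStrongDual x - c (ρ x)‖ ≤ 1 / 2)
    {V : Submodule 𝕜 X} (hV : Isometry (restrictToSubspace V (visibleDual ρ c V))) :
    Function.Surjective (restrictToSubspace V (visibleDual ρ c V)) := by
  let W : Submodule 𝕜 (StrongDual 𝕜 V) :=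
    { carrier := range (restrictToSubspace V (visibleDual ρ c V))
      add_mem' := by
        rintro _ _ ⟨a, rfl⟩ ⟨b, rfl⟩
        exact ⟨a + b, by ext v; simp [restrictToSubspace]⟩
      zero_mem' := ⟨0, by ext v; simp [restrictToSubspace]⟩
      smul_mem' := by
        rintro k _ ⟨a, rfl⟩
        exact ⟨k • a, by ext v; simp [restrictToSubspace]⟩ }
  have : CompleteSpace (visibleDual ρ c V) := (isClosed_visibleDual V).completeSpace_coe
  have hW : IsClosed (W : Set (StrongDual 𝕜 V)) := hV.isClosedEmbedding.isClosed_range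
  have htop : W = ⊤ := Submodule.eq_top_of_half_dense hW fun f hf => by
    obtain ⟨ξ, hξ, h⟩ := exists_visibleRank_near hρ hc V f hf
    exact ⟨_, ⟨⟨c ξ, apply_mem_visibleDual hξ⟩, rfl⟩, h⟩
  exact fun f => (htop ▸ Submodule.mem_top : f ∈ W)

theorem visibleDual_top
    (hc : ∀ x ∈ dualBall 𝕜 X 1, ‖WeakDual.toStrongDual x - c (ρ x)‖ ≤ 1 / 2) :
    visibleDual ρ c (⊤ : Submodule 𝕜 X) = ⊤ := by
  refine Submodule.eq_top_of_half_dense (isClosed_visibleDual _) fun f hf => ?_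
  have hfB : StrongDual.toWeakDual f ∈ dualBall 𝕜 X 1 := mem_dualBall.2 hf
  refine ⟨_, apply_mem_visibleDual ⟨_, hfB, rfl, fun y _ hy => ?_⟩, hc _ hfB⟩
  rw [show y = StrongDual.toWeakDual f from DFunLike.ext _ _ fun v => hy v trivial]

/-- Every functional belongs to the visible dual of some closed separable subspace, since `X` is
the directed union of its finite-dimensional subspaces. -/
theorem exists_mem_visibleDual (hρ : ∀ ξ, IsCompact {x ∈ dualBall 𝕜 X 1 | ξ ≤ ρ x})
    (hc : ∀ x ∈ dualBall 𝕜 X 1, ‖WeakDual.toStrongDual x - c (ρ x)‖ ≤ 1 / 2)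
    (y : StrongDual 𝕜 X) :
    ∃ C : Set X, C.Countable ∧
      y ∈ visibleDual ρ c (Submodule.span 𝕜 C).topologicalClosure := by
  classical
  let F : Finset X → Submodule 𝕜 X := fun s => Submodule.span 𝕜 (s : Set X)
  have hF : Directed (· ≤ ·) F := (show Monotone F from fun s t h =>
    Submodule.span_mono (Finset.coe_subset.2 h)).directed_le
  have htop : (⨆ s, F s).topologicalClosure = ⊤ := top_le_iff.1 fun x _ =>
    Submodule.le_topologicalClosure _ (le_iSup F {x} (Submodule.subset_span (by simp)))
  have hy : y ∈ (⨆ s, visibleDual ρ c (F s)).topologicalClosure := by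
    rw [← visibleDual_closure_iSup hF hρ, htop, visibleDual_top hc]
    trivial
  obtain ⟨z, hz, hlim⟩ := mem_closure_iff_seq_limit.1 hy
  choose s hs using fun n =>
    (Submodule.mem_iSup_of_directed _ (directed_visibleDual hF)).1 (hz n)
  refine ⟨⋃ n, (s n : Set X), countable_iUnion fun n => (s n).countable_toSet, ?_⟩
  refine (isClosed_visibleDual _).mem_of_tendsto hlim (.of_forall fun n => ?_)
  exact visibleDual_mono ((Submodule.span_mono (subset_iUnion (fun n => (s n : Set X)) n)).trans
    (Submodule.le_topologicalClosure _)) (hs n)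

theorem exists_subset_visibleDual (hρ : ∀ ξ, IsCompact {x ∈ dualBall 𝕜 X 1 | ξ ≤ ρ x})
    (hc : ∀ x ∈ dualBall 𝕜 X 1, ‖WeakDual.toStrongDual x - c (ρ x)‖ ≤ 1 / 2)
    {Z : Set (StrongDual 𝕜 X)} (hZ : TopologicalSpace.IsSeparable Z) :
    ∃ V ∈ closedSeparableSubspaces 𝕜 X, Z ⊆ visibleDual ρ c V := by
  obtain ⟨D, hD, hZD⟩ := hZ
  choose C hC hyC using exists_mem_visibleDual hρ hc
  refine ⟨(Submodule.span 𝕜 (⋃ y ∈ D, C y)).topologicalClosure,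
    closedSpan_mem_closedSeparableSubspaces (hD.biUnion fun y _ => hC y).isSeparable,
    hZD.trans (closure_minimal (fun y hy => ?_) (isClosed_visibleDual _))⟩
  exact visibleDual_mono (Submodule.topologicalClosure_mono
    (Submodule.span_mono (subset_biUnion_of_mem (u := C) hy))) (hyC y)

theorem isClosed_normed_by (V : Submodule 𝕜 X) :
    IsClosed {y : StrongDual 𝕜 X | ‖y‖ ≤ ‖y.comp V.subtypeL‖} :=
  isClosed_le continuous_norm
    (ContinuousLinearMap.continuous (V.subtypeL.precomp 𝕜)).norm

theorem norm_comp_subtypeL_mono {V W : Submodule 𝕜 X} (h : V ≤ W) (y : StrongDual 𝕜 X) :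
    ‖y.comp V.subtypeL‖ ≤ ‖y.comp W.subtypeL‖ :=
  ContinuousLinearMap.opNorm_le_bound _ (norm_nonneg _) fun v =>
    (y.comp W.subtypeL).le_opNorm ⟨v, h v.2⟩

/-- A separable set of functionals is normed by a closed separable subspace. -/
theorem exists_norming_subspace {V : Submodule 𝕜 X} (hV : V ∈ closedSeparableSubspaces 𝕜 X)
    {Z : Set (StrongDual 𝕜 X)} (hZ : TopologicalSpace.IsSeparable Z) :
    ∃ W ∈ closedSeparableSubspaces 𝕜 X, V ≤ W ∧ ∀ y ∈ Z, ‖y‖ ≤ ‖y.comp W.subtypeL‖ := by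
  obtain ⟨D, hD, hZD⟩ := hZ
  have hex : ∀ (y : StrongDual 𝕜 X) (n : ℕ), ∃ x : X, ‖x‖ < 1 ∧ ‖y‖ - 1 / (n + 1 : ℝ) < ‖y x‖ :=
    fun y n => y.exists_lt_apply_of_lt_opNorm (by
      have : 0 < 1 / (n + 1 : ℝ) := by positivity
      linarith)
  choose x hx hxy using hex
  let C : Set X := ⋃ y ∈ D, range (x y)
  have hC : C.Countable := hD.biUnion fun y _ => countable_range _
  obtain ⟨W, hWS, hVW, hCW⟩ : ∃ W ∈ closedSeparableSubspaces 𝕜 X, V ≤ W ∧ C ⊆ W :=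
    ⟨(Submodule.span 𝕜 (V ∪ C)).topologicalClosure,
      closedSpan_mem_closedSeparableSubspaces (hV.2.union hC.isSeparable),
      fun v hv => subset_closedSpan _ (Or.inl hv), fun v hv => subset_closedSpan _ (Or.inr hv)⟩
  refine ⟨W, hWS, hVW, fun y hy => closure_minimal (fun y hy => ?_) (isClosed_normed_by _) (hZD hy)⟩
  change ‖y‖ ≤ ‖y.comp W.subtypeL‖
  refine le_of_forall_pos_le_add fun ε hε => ?_
  obtain ⟨n, hn⟩ := exists_nat_one_div_lt hε
  have hxW : x y n ∈ W := hCW (mem_biUnion hy (mem_range_self n))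
  have h1 : ‖y (x y n)‖ ≤ ‖y.comp W.subtypeL‖ * ‖x y n‖ :=
    (y.comp W.subtypeL).le_opNorm ⟨x y n, hxW⟩
  have h2 : ‖y.comp W.subtypeL‖ * ‖x y n‖ ≤ ‖y.comp W.subtypeL‖ * 1 := by
    gcongr
    exact (hx y n).le
  linarith [hxy y n]

/-- If each `Y(V n)` is normed by some `V m`, then the closure of `⋃ n, V n` norms its visible
dual, because this is the closure of `⋃ n, Y(V n)`. -/
theorem isometry_restrict_closure_iSup (hρ : ∀ ξ, IsCompact {x ∈ dualBall 𝕜 X 1 | ξ ≤ ρ x})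
    {V : ℕ → Submodule 𝕜 X} (hV : Monotone V)
    (h : ∀ n, ∀ y ∈ visibleDual ρ c (V n), ∃ m, ‖y‖ ≤ ‖y.comp (V m).subtypeL‖) :
    Isometry (restrictToSubspace (⨆ n, V n).topologicalClosure
      (visibleDual ρ c (⨆ n, V n).topologicalClosure)) := by
  rw [isometry_restrictToSubspace_iff, visibleDual_closure_iSup hV.directed_le hρ]
  intro y hy
  refine closure_minimal (fun z hz => ?_) (isClosed_normed_by _) hy
  obtain ⟨n, hn⟩ :=
    (Submodule.mem_iSup_of_directed _ (directed_visibleDual hV.directed_le)).1 hz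
  obtain ⟨m, hm⟩ := h n z hn
  exact hm.trans (norm_comp_subtypeL_mono
    ((le_iSup V m).trans (Submodule.le_topologicalClosure _)) z)

/-- Every closed separable subspace is contained in one which norms its visible dual: iterate
`exists_norming_subspace` and take the closed union. -/
theorem exists_le_isometry_restrict (hρ : ∀ ξ, IsCompact {x ∈ dualBall 𝕜 X 1 | ξ ≤ ρ x})
    {V₀ : Submodule 𝕜 X} (hV₀ : V₀ ∈ closedSeparableSubspaces 𝕜 X) :
    ∃ V ∈ closedSeparableSubspaces 𝕜 X, V₀ ≤ V ∧
      Isometry (restrictToSubspace V (visibleDual ρ c V)) := by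
  have hstep : ∀ V : closedSeparableSubspaces 𝕜 X, ∃ W : closedSeparableSubspaces 𝕜 X,
      V.1 ≤ W.1 ∧ ∀ y ∈ visibleDual ρ c V.1, ‖y‖ ≤ ‖y.comp W.1.subtypeL‖ := fun V =>
    let ⟨W, hW, h⟩ := exists_norming_subspace V.2
      (visibleDual_mem_closedSeparableSubspaces V.2.2 hρ (c := c)).2
    ⟨⟨W, hW⟩, h⟩
  choose g hg hgn using hstep
  let V : ℕ → closedSeparableSubspaces 𝕜 X := fun n => g^[n] ⟨V₀, hV₀⟩
  have hsucc : ∀ n, V (n + 1) = g (V n) := fun n => Function.iterate_succ_apply' g n _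
  have hmono : Monotone fun n => (V n).1 := monotone_nat_of_le_succ fun n => by
    rw [hsucc]
    exact hg _
  refine ⟨(⨆ n, (V n).1).topologicalClosure,
    closedIUnion_mem_closedSeparableSubspaces hmono fun n => (V n).2,
    (le_iSup (fun n => (V n).1) 0).trans (Submodule.le_topologicalClosure _),
    isometry_restrict_closure_iSup hρ hmono fun n y hy => ⟨n + 1, ?_⟩⟩
  rw [hsucc]
  exact hgn _ y hy

/-- The rectangles `V × Y(V)`, where `Y(V)` is the visible dual of `V` and is normed by `V`, form
the required rich family. -/
theorem IsDualFragmented.exists_rich_family (hX : IsDualFragmented 𝕜 X) :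
    ∃ A : Set (Submodule 𝕜 (X × StrongDual 𝕜 X)),
      A ⊆ rectangles 𝕜 X (StrongDual 𝕜 X) ∧
      IsRichFamily A ∧
      (∀ (V₁ V₂ : Submodule 𝕜 X) (Y₁ Y₂ : Submodule 𝕜 (StrongDual 𝕜 X)),
        V₁.prod Y₁ ∈ A → V₂.prod Y₂ ∈ A → V₁ ≤ V₂ → Y₁ ≤ Y₂) ∧
      (∀ (V : Submodule 𝕜 X) (Y : Submodule 𝕜 (StrongDual 𝕜 X)), V.prod Y ∈ A →
        Isometry (restrictToSubspace V Y) ∧ Function.Surjective (restrictToSubspace V Y)) := by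
  classical
  obtain ⟨ρ, hρ, hρd⟩ := hX.exists_rank 1 (show (0 : ℝ) < 1 / 2 by norm_num)
  -- `c ξ` is a functional of rank `ξ` in the unit ball; the value `0` at other `ξ` plays no role
  let c : Ordinal.{max u v} → StrongDual 𝕜 X := fun ξ =>
    if h : ∃ x ∈ dualBall 𝕜 X 1, ρ x = ξ then WeakDual.toStrongDual h.choose else 0
  have hc : ∀ x ∈ dualBall 𝕜 X 1, ‖WeakDual.toStrongDual x - c (ρ x)‖ ≤ 1 / 2 := by
    intro x hx
    have h : ∃ y ∈ dualBall 𝕜 X 1, ρ y = ρ x := ⟨x, hx, rfl⟩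
    have hcx : c (ρ x) = WeakDual.toStrongDual h.choose := dif_pos h
    rw [hcx]
    exact hρd _ hx _ h.choose_spec.1 h.choose_spec.2.symm
  let Y : Submodule 𝕜 X → Submodule 𝕜 (StrongDual 𝕜 X) := visibleDual ρ c
  have hYS : ∀ V ∈ closedSeparableSubspaces 𝕜 X,
      Y V ∈ closedSeparableSubspaces 𝕜 (StrongDual 𝕜 X) := fun V hV =>
    visibleDual_mem_closedSeparableSubspaces hV.2 hρ
  let A : Set (Submodule 𝕜 (X × StrongDual 𝕜 X)) := {W | ∃ V ∈ closedSeparableSubspaces 𝕜 X,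
    Isometry (restrictToSubspace V (Y V)) ∧ W = V.prod (Y V)}
  have hA : ∀ V Z, V.prod Z ∈ A → Isometry (restrictToSubspace V (Y V)) ∧ Z = Y V := by
    rintro V Z ⟨V', -, hiso, h⟩
    obtain ⟨h1, h2⟩ := Submodule.prod_le_prod_iff.1 h.le
    obtain ⟨h3, h4⟩ := Submodule.prod_le_prod_iff.1 h.ge
    obtain rfl := le_antisymm h1 h3
    exact ⟨hiso, le_antisymm h2 h4⟩
  refine ⟨A, ?_, ⟨?_, ?_, ?_⟩, ?_, ?_⟩
  · rintro _ ⟨V, hV, -, rfl⟩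
    exact ⟨V, hV, Y V, hYS V hV, rfl⟩
  · rintro _ ⟨V, hV, -, rfl⟩
    exact ⟨hV.1.prod (hYS V hV).1, hV.2.prod (hYS V hV).2⟩
  · rintro W ⟨-, hW⟩
    obtain ⟨V₁, hV₁, hZ⟩ := exists_subset_visibleDual hρ hc (hW.image continuous_snd)
    obtain ⟨V, hV, hle, hiso⟩ := exists_le_isometry_restrict (c := c) hρ
      (closedSpan_mem_closedSeparableSubspaces (𝕜 := 𝕜) ((hW.image continuous_fst).union hV₁.2))
    have hsub := (subset_closedSpan (𝕜 := 𝕜) _).trans (SetLike.coe_subset_coe.2 hle)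
    refine ⟨V.prod (Y V), ⟨V, hV, hiso, rfl⟩, fun w hw => ⟨?_, ?_⟩⟩
    · exact hsub (Or.inl (mem_image_of_mem Prod.fst hw))
    · exact visibleDual_mono (fun v hv => hsub (Or.inr hv)) (hZ (mem_image_of_mem Prod.snd hw))
  · intro W hW hWA
    choose V hV hiso hWV using hWA
    have hmono : Monotone V := fun m n hmn => by
      have h := hW hmn
      rw [hWV m, hWV n] at h
      exact (Submodule.prod_le_prod_iff.1 h).1
    refine ⟨(⨆ n, V n).topologicalClosure, closedIUnion_mem_closedSeparableSubspaces hmono hV,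
      isometry_restrict_closure_iSup hρ hmono fun n y hy =>
        ⟨n, isometry_restrictToSubspace_iff.1 (hiso n) y hy⟩, ?_⟩
    apply SetLike.coe_injective
    simp only [Y]
    rw [visibleDual_closure_iSup hmono.directed_le hρ, Submodule.prod_coe,
      Submodule.topologicalClosure_coe, Submodule.topologicalClosure_coe,
      Submodule.topologicalClosure_coe, ← closure_prod_eq, ← Submodule.prod_coe,
      ← Submodule.iSup_prod]
    simp only [hWV, Y]
  · intro V₁ V₂ Y₁ Y₂ h₁ h₂ hle
    rw [(hA _ _ h₁).2, (hA _ _ h₂).2]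
    exact visibleDual_mono hle
  · intro V Z h
    obtain ⟨hiso, rfl⟩ := hA V Z h
    exact ⟨hiso, surjective_restrictToSubspace_visibleDual hρ hc hiso⟩

/-! ### Rich families: separable duals of separable subspaces -/

/-- A separable subspace `V` lies in the first side of a rectangle `V' × Y` of the family, and
restriction maps the separable space `Y` onto `V*` by the Hahn–Banach theorem. -/
theorem separableSpace_dual_of_rich_family {A : Set (Submodule 𝕜 (X × StrongDual 𝕜 X))}
    (hA : A ⊆ rectangles 𝕜 X (StrongDual 𝕜 X)) (hrich : IsRichFamily A)
    (hsurj : ∀ (V : Submodule 𝕜 X) (Y : Submodule 𝕜 (StrongDual 𝕜 X)), V.prod Y ∈ A →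
      Function.Surjective (restrictToSubspace V Y))
    {V : Submodule 𝕜 X} (hV : TopologicalSpace.IsSeparable (V : Set X)) :
    TopologicalSpace.SeparableSpace (StrongDual 𝕜 V) := by
  have hmem : V.topologicalClosure.prod (⊥ : Submodule 𝕜 (StrongDual 𝕜 X)) ∈
      closedSeparableSubspaces 𝕜 (X × StrongDual 𝕜 X) := by
    refine ⟨(Submodule.isClosed_topologicalClosure _).prod ?_, hV.closure.prod ?_⟩
    · exact isClosed_singleton
    · exact (countable_singleton _).isSeparable
  obtain ⟨W, hWA, hle⟩ := hrich.cofinal _ hmem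
  obtain ⟨V', -, Y, hY, rfl⟩ := hA hWA
  have hVV' : V ≤ V' := V.le_topologicalClosure.trans (Submodule.prod_le_prod_iff.1 hle).1
  have : TopologicalSpace.SeparableSpace Y := hY.2.separableSpace
  let r : Y → StrongDual 𝕜 V := fun y => (y : StrongDual 𝕜 X).comp V.subtypeL
  have hr : Continuous r :=
    (ContinuousLinearMap.continuous (V.subtypeL.precomp 𝕜)).comp continuous_subtype_val
  have hrs : Function.Surjective r := by
    intro f
    obtain ⟨g, hg, -⟩ := exists_extension_norm_eq V f
    obtain ⟨y, hy⟩ := hsurj V' Y hWA (g.comp V'.subtypeL)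
    refine ⟨y, ContinuousLinearMap.ext fun v => ?_⟩
    rw [← hg v]
    exact DFunLike.congr_fun hy ⟨v, hVV' v.2⟩
  exact hrs.denseRange.separableSpace hr

end RichFamily

theorem theoremt (𝕜 : Type*) [RCLike 𝕜] (X : Type*) [NormedAddCommGroup X] [NormedSpace 𝕜 X]
    [CompleteSpace X] :
    List.TFAE [
      IsAsplund 𝕜 X,
      ∀ V : Submodule 𝕜 X, TopologicalSpace.IsSeparable (V : Set X) →
        TopologicalSpace.SeparableSpace (StrongDual 𝕜 V),
      ∃ A : Set (Submodule 𝕜 (X × StrongDual 𝕜 X)),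
        A ⊆ rectangles 𝕜 X (StrongDual 𝕜 X) ∧
        IsRichFamily A ∧
        (∀ (V₁ V₂ : Submodule 𝕜 X) (Y₁ Y₂ : Submodule 𝕜 (StrongDual 𝕜 X)),
          V₁.prod Y₁ ∈ A → V₂.prod Y₂ ∈ A → V₁ ≤ V₂ → Y₁ ≤ Y₂) ∧
        (∀ (V : Submodule 𝕜 X) (Y : Submodule 𝕜 (StrongDual 𝕜 X)), V.prod Y ∈ A →
          Isometry (restrictToSubspace V Y) ∧ Function.Surjective (restrictToSubspace V Y))] := by
  have h1 : IsAsplund 𝕜 X ↔ IsDualFragmented 𝕜 X := by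
    let : NormedSpace ℝ X := NormedSpace.restrictScalars ℝ 𝕜 X
    have : IsScalarTower ℝ 𝕜 X := .restrictScalars ℝ 𝕜 X
    exact ⟨IsRealAsplund.isDualFragmented, IsDualFragmented.isRealAsplund⟩
  tfae_have 1 → 3 := fun h => (h1.1 h).exists_rich_family
  tfae_have 3 → 2 := fun ⟨A, hA, hrich, _, hiso⟩ _ hV =>
    separableSpace_dual_of_rich_family hA hrich (fun V Y h => (hiso V Y h).2) hV
  tfae_have 2 → 1 := fun h => h1.2 (isDualFragmented_of_separable_duals h)
  tfae_finish
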